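/- Let $X$ be a real Banach space with dual $X^*$. Let $\mathcal B$ be the set of closed unit balls of norms on $X$ equivalent to the given norm. For $B\in\mathcal B$ let $\|\cdot\|_B$ be the norm with closed unit ball $B$ and $\|\cdot\|_B^*$ its dual norm on $X^*$. Put $$h(B_1,B_2)=\inf\{\varepsilon>0 : B_1\subseteq B_2+\varepsilon B_2 \text{ and } B_2\subseteq B_1+\varepsilon B_1\}\qquad(B_1,B_2\in\mathcal B),$$ and give $\mathcal B$ the topology induced by $h$: a set $U\subseteq\mathcal B$ is open if for every $B\in U$ there is $\varepsilon>0$ such that every $B'\in\mathcal B$ with $h(B,B')<\varepsilon$ lies in $U$. (This is the topology of the metric $\log(1+h)$.) Let $\mathcal Z$ be the set of weak*-closed subspaces of $X^*$ of finite codimension. For $Z\in\mathcal Z$ and $B\in\mathcal B$ put $\|x\|_{Z,B}=\sup\{|g(x)| : g\in Z,\ \|g\|_B^*\le 1\}$ for $x\in X$. The space $(X,\|\cdot\|_B)$ has the *asymptotic hyperplane uniform Mazur intersection property* (AHUMIP) if for all $\varepsilon>0$ and $M\ge 1$ there are $\gamma,K>0$ such that for every $f\in X^*$ with $\|f\|_B^*=1$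 there is $Z\in\mathcal Z$ with $f\in Z$ such that for every closed convex set $C\subseteq X$ with $\|x\|_{Z,B}\le M$ for all $x\in C$ and $\inf f(C)\ge\varepsilon$, there are $z_0\in X$ and $0<r_0\le K$ with $\|x-z_0\|_{Z,B}\le r_0$ for all $x\in C$ and $\inf f(\{y\in X: \|y-z_0\|_B\le r_0\})\ge\gamma$. **Theorem.** If $X$ with its given norm has AHUMIP, then there is a dense $G_\delta$ subset $\mathcal B_0$ of $\mathcal B$ such that $(X,\|\cdot\|_B)$ has AHUMIP for every $B\in\mathcal B_0$. -/

import Mathlib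

open scoped Pointwise Topology

noncomputable section

/-- The unit balls of the norms on `X` that are equivalent to the given one.
A norm equivalent to `‖·‖` is a seminorm `p` with `c ‖x‖ ≤ p x ≤ C ‖x‖` for some `c, C > 0`. -/
structure EquivBall (X : Type*) [NormedAddCommGroup X] [NormedSpace ℝ X] where
  carrier : Set X
  isUnitBall : ∃ p : Seminorm ℝ X,
    (∃ c C : ℝ, 0 < c ∧ 0 < C ∧ ∀ x : X, c * ‖x‖ ≤ p x ∧ p x ≤ C * ‖x‖) ∧
    carrier = {x : X | p x ≤ 1}

namespace EquivBall

section Basic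

variable {X : Type*} [NormedAddCommGroup X] [NormedSpace ℝ X]

/-- The norm `‖·‖_B` with closed unit ball `B`, as the Minkowski functional of `B`. -/
def norm (B : EquivBall X) (x : X) : ℝ := gauge B.carrier x

/-- `‖·‖_B` is the norm that `B` is the unit ball of. -/
theorem norm_eq (B : EquivBall X) (p : Seminorm ℝ X) (hp : B.carrier = {x : X | p x ≤ 1})
    (x : X) : B.norm x = p x := by
  have h : B.carrier = p.closedBall 0 1 := by
    rw [hp]; ext y; simp [Seminorm.mem_closedBall]
  have hsub : p.ball 0 1 ⊆ p.closedBall 0 1 := fun y hy => by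
    rw [Seminorm.mem_ball] at hy; exact (Seminorm.mem_closedBall _).2 hy.le
  have habs : Absorbent ℝ (p.ball 0 1) := Seminorm.absorbent_ball_zero p one_pos
  rw [norm, h]
  refine le_antisymm ?_ ?_
  · have := gauge_mono habs hsub x
    rwa [Seminorm.gauge_ball] at this
  · by_contra! hlt
    obtain ⟨r, hr, hrp, y, hy, rfl⟩ := exists_lt_of_gauge_lt (habs.mono hsub) hlt
    have hy1 : p y ≤ 1 := by simpa [Seminorm.mem_closedBall] using hy
    have : p (r • y) = r * p y := by rw [map_smul_eq_mul, Real.norm_of_nonneg hr.le]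
    simp only [this] at hrp
    nlinarith

/-- The dual norm `‖f‖*_B = sup {|f x| : x ∈ B}` on the dual space. -/
def dualNorm (B : EquivBall X) (f : StrongDual ℝ X) : ℝ :=
  sSup ((fun x : X => |f x|) '' B.carrier)

/-- The seminorm `‖x‖_{Z,B} = sup {|g x| : g ∈ Z, ‖g‖*_B ≤ 1}`. -/
def normOn (B : EquivBall X) (Z : Submodule ℝ (StrongDual ℝ X)) (x : X) : ℝ :=
  sSup ((fun g : StrongDual ℝ X => |g x|) '' {g : StrongDual ℝ X | g ∈ Z ∧ B.dualNorm g ≤ 1})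

/-- `h(B₁, B₂) = inf {ε > 0 : B₁ ⊆ B₂ + ε B₂ and B₂ ⊆ B₁ + ε B₁}`. -/
def hausdorff (B₁ B₂ : EquivBall X) : ℝ :=
  sInf {ε : ℝ | 0 < ε ∧ B₁.carrier ⊆ B₂.carrier + ε • B₂.carrier ∧
    B₂.carrier ⊆ B₁.carrier + ε • B₁.carrier}

/-- The topology of `h`: a set is open if with each of its points `B` it contains some
`h`-ball `{B' : h(B, B') < ε}`, `ε > 0`. -/
instance instTopologicalSpace : TopologicalSpace (EquivBall X) where
  IsOpen U := ∀ B ∈ U, ∃ ε : ℝ, 0 < ε ∧ ∀ B' : EquivBall X, hausdorff B B' < ε → B' ∈ U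
  isOpen_univ := fun _ _ => ⟨1, one_pos, fun _ _ => trivial⟩
  isOpen_inter := by
    intro U V hU hV B hB
    obtain ⟨a, ha, hUa⟩ := hU B hB.1
    obtain ⟨b, hb, hVb⟩ := hV B hB.2
    exact ⟨min a b, lt_min ha hb, fun B' h =>
      ⟨hUa B' (h.trans_le (min_le_left _ _)), hVb B' (h.trans_le (min_le_right _ _))⟩⟩
  isOpen_sUnion := by
    intro S hS B hB
    obtain ⟨U, hU, hBU⟩ := hB
    obtain ⟨a, ha, hUa⟩ := hS U hU B hBU
    exact ⟨a, ha, fun B' h => ⟨U, hU, hUa B' h⟩⟩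

variable (X) in
/-- The closed unit ball `B(X)` of the given norm. -/
def original : EquivBall X where
  carrier := Metric.closedBall 0 1
  isUnitBall := ⟨normSeminorm ℝ X, ⟨1, 1, one_pos, one_pos, fun x => by simp⟩, by
    ext x; simp⟩

theorem original_norm (x : X) : (original X).norm x = ‖x‖ :=
  norm_eq (original X) (normSeminorm ℝ X) (by ext y; simp [original]) x

theorem original_dualNorm (f : StrongDual ℝ X) : (original X).dualNorm f = ‖f‖ :=
  f.sSup_unitClosedBall_eq_norm

end Basic

end EquivBall

/-- `Z` is a weak*-closed subspace of `X*` of finite codimension. -/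
def IsWeakStarClosedFiniteCodim {X : Type*} [NormedAddCommGroup X] [NormedSpace ℝ X]
    (Z : Submodule ℝ (StrongDual ℝ X)) : Prop :=
  IsClosed (StrongDual.toWeakDual '' (Z : Set (StrongDual ℝ X))) ∧
    FiniteDimensional ℝ (StrongDual ℝ X ⧸ Z)

/-- The asymptotic hyperplane uniform Mazur intersection property of `(X, ‖·‖_B)`.
The functionals in `X*`, the closed subsets of `X` and the weak* topology of `X*` are the same
for all equivalent norms. -/
def AHUMIP {X : Type*} [NormedAddCommGroup X] [NormedSpace ℝ X] (B : EquivBall X) : Prop :=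
  ∀ ε M : ℝ, 0 < ε → 1 ≤ M → ∃ γ K : ℝ, 0 < γ ∧ 0 < K ∧
    ∀ f : StrongDual ℝ X, B.dualNorm f = 1 →
      ∃ Z : Submodule ℝ (StrongDual ℝ X), IsWeakStarClosedFiniteCodim Z ∧ f ∈ Z ∧
        ∀ C : Set X, IsClosed C → Convex ℝ C →
          (∀ x ∈ C, B.normOn Z x ≤ M) → (∀ x ∈ C, ε ≤ f x) →
            ∃ (z₀ : X) (r₀ : ℝ), 0 < r₀ ∧ r₀ ≤ K ∧
              (∀ x ∈ C, B.normOn Z (x - z₀) ≤ r₀) ∧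
              (∀ y : X, B.norm (y - z₀) ≤ r₀ → γ ≤ f y)

end

/-! The set of all balls with AHUMIP is itself a dense Gδ. Everything rests on `forall_ball_le_iff`,
which turns the ball condition into the single inequality `γ + r * B.dualNorm f ≤ f z`.

Gδ: this inequality has slack `γ` and the radii are bounded by `K`, so a small change of norm, which
rescales all norms involved by factors near 1, costs only part of `γ` and slightly worsens `ε` and
`M` (`SeparatesAt.exists_hausdorff_lt`). Letting `ε → 0` and `M → ∞` along a sequence gives
countably many open conditions.

Density: replace `B` by the closure `D` of `B + θ B₀`, where `B₀` has AHUMIP and `θ` is small. Dual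
norms add, `‖g‖*_D = ‖g‖*_B + θ ‖g‖*_{B₀}`. If `C` is `r`-close to `z` for `B₀` and `Z`, put `ρ = r
/ θ` and let `u ∈ B` almost norm `f`. Then `C` is `ρ`-close to `z + ρ u` for `D` and the same `Z`,
and moving the centre by `ρ u` raises `f` by almost `ρ ‖f‖*_B`, which pays for the `B` part of the
new ball (`AHUMIP_of_dualNorm_eq_add`). -/

namespace EquivBall

/-! ### Equivalent norms and the distance `h` -/

section Norms

variable {X : Type*} [NormedAddCommGroup X] [NormedSpace ℝ X]

theorem exists_seminorm (B : EquivBall X) : ∃ p : Seminorm ℝ X,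
    (∃ c C : ℝ, 0 < c ∧ 0 < C ∧ ∀ x : X, c * ‖x‖ ≤ p x ∧ p x ≤ C * ‖x‖) ∧
    (∀ x, B.norm x = p x) ∧ ∀ x, x ∈ B.carrier ↔ p x ≤ 1 := by
  obtain ⟨p, hb, hp⟩ := B.isUnitBall
  exact ⟨p, hb, norm_eq B p hp, fun x => by rw [hp]; rfl⟩

theorem mem_carrier (B : EquivBall X) {x : X} : x ∈ B.carrier ↔ B.norm x ≤ 1 := by
  obtain ⟨p, -, hn, hm⟩ := B.exists_seminorm
  rw [hm, hn]

theorem exists_bounds (B : EquivBall X) :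
    ∃ c C : ℝ, 0 < c ∧ 0 < C ∧ ∀ x : X, c * ‖x‖ ≤ B.norm x ∧ B.norm x ≤ C * ‖x‖ := by
  obtain ⟨p, hb, hn, -⟩ := B.exists_seminorm
  simpa only [hn] using hb

theorem norm_nonneg (B : EquivBall X) (x : X) : 0 ≤ B.norm x := by
  obtain ⟨p, -, hn, -⟩ := B.exists_seminorm
  rw [hn]; exact apply_nonneg p x

theorem norm_zero (B : EquivBall X) : B.norm 0 = 0 := by
  obtain ⟨p, -, hn, -⟩ := B.exists_seminorm
  rw [hn, map_zero]

theorem norm_smul (B : EquivBall X) (a : ℝ) (x : X) : B.norm (a • x) = |a| * B.norm x := by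
  obtain ⟨p, -, hn, -⟩ := B.exists_seminorm
  rw [hn, hn, map_smul_eq_mul, Real.norm_eq_abs]

theorem norm_add_le (B : EquivBall X) (x y : X) : B.norm (x + y) ≤ B.norm x + B.norm y := by
  obtain ⟨p, -, hn, -⟩ := B.exists_seminorm
  simpa only [hn] using map_add_le_add p x y

theorem norm_le_mul_norm (B B' : EquivBall X) : ∃ k : ℝ, 0 < k ∧ ∀ x, B.norm x ≤ k * B'.norm x := by
  obtain ⟨c, C, hc, hC, h⟩ := B.exists_bounds
  obtain ⟨c', C', hc', hC', h'⟩ := B'.exists_bounds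
  refine ⟨C / c', div_pos hC hc', fun x => (h x).2.trans ?_⟩
  rw [div_mul_eq_mul_div, le_div_iff₀ hc', mul_assoc, mul_comm ‖x‖]
  exact mul_le_mul_of_nonneg_left (h' x).1 hC.le

theorem norm_inv_smul_le (B : EquivBall X) {a : ℝ} (ha : 0 < a) {x : X} (hx : B.norm x ≤ a) :
    B.norm (a⁻¹ • x) ≤ 1 := by
  rw [norm_smul, abs_of_pos (inv_pos.2 ha), inv_mul_le_iff₀ ha, mul_one]
  exact hx

theorem mem_add_smul_iff (B : EquivBall X) {e : ℝ} (he : 0 < e) {x : X} :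
    x ∈ B.carrier + e • B.carrier ↔ B.norm x ≤ 1 + e := by
  constructor
  · rintro ⟨y, hy, _, ⟨z, hz, rfl⟩, rfl⟩
    rw [mem_carrier] at hy hz
    refine (B.norm_add_le _ _).trans (add_le_add hy ?_)
    change B.norm (e • z) ≤ e
    rw [norm_smul, abs_of_pos he]
    exact mul_le_of_le_one_right he.le hz
  · intro hx
    have h1 : 0 < 1 + e := by positivity
    have hy := B.mem_carrier.2 (B.norm_inv_smul_le h1 hx)
    refine ⟨_, hy, _, ⟨_, hy, rfl⟩, ?_⟩
    change (1 + e)⁻¹ • x + e • (1 + e)⁻¹ • x = x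
    rw [smul_smul, ← add_smul, show (1 + e)⁻¹ + e * (1 + e)⁻¹ = 1 by field_simp, one_smul]

theorem subset_add_smul_iff (B B' : EquivBall X) {e : ℝ} (he : 0 < e) :
    B.carrier ⊆ B'.carrier + e • B'.carrier ↔ ∀ x, B.norm x ≤ 1 → B'.norm x ≤ 1 + e := by
  refine forall_congr' fun x => ?_
  rw [mem_add_smul_iff _ he, mem_carrier]

theorem hausdorff_le {B B' : EquivBall X} {e : ℝ} (he : 0 < e)
    (h : ∀ x, B.norm x ≤ 1 → B'.norm x ≤ 1 + e) (h' : ∀ x, B'.norm x ≤ 1 → B.norm x ≤ 1 + e) :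
    hausdorff B B' ≤ e :=
  csInf_le ⟨0, fun _ hd => hd.1.le⟩
    ⟨he, (subset_add_smul_iff _ _ he).2 h, (subset_add_smul_iff _ _ he).2 h'⟩

theorem norm_le_of_hausdorff_lt {B B' : EquivBall X} {e : ℝ} (h : hausdorff B B' < e) :
    (∀ x, B.norm x ≤ 1 → B'.norm x ≤ 1 + e) ∧ ∀ x, B'.norm x ≤ 1 → B.norm x ≤ 1 + e := by
  have hne : {ε : ℝ | 0 < ε ∧ B.carrier ⊆ B'.carrier + ε • B'.carrier ∧
      B'.carrier ⊆ B.carrier + ε • B.carrier}.Nonempty := by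
    obtain ⟨k, hk, h1⟩ := norm_le_mul_norm B B'
    obtain ⟨l, hl, h2⟩ := norm_le_mul_norm B' B
    have hkl : 0 < k + l := add_pos hk hl
    refine ⟨k + l, hkl, (subset_add_smul_iff _ _ hkl).2 fun x hx => ?_,
      (subset_add_smul_iff _ _ hkl).2 fun x hx => ?_⟩
    · have := mul_le_of_le_one_right hl.le hx
      linarith [h2 x]
    · have := mul_le_of_le_one_right hk.le hx
      linarith [h1 x]
  obtain ⟨d, ⟨hd, hd1, hd2⟩, hde⟩ := exists_lt_of_csInf_lt hne h
  rw [subset_add_smul_iff _ _ hd] at hd1 hd2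
  exact ⟨fun x hx => (hd1 x hx).trans (by linarith), fun x hx => (hd2 x hx).trans (by linarith)⟩

end Norms

/-! ### Dual norms and the seminorms `‖·‖_{Z,B}` -/

section Dual

variable {X : Type*} [NormedAddCommGroup X] [NormedSpace ℝ X]

theorem bddAbove_dualNorm (B : EquivBall X) (g : StrongDual ℝ X) :
    BddAbove ((fun x : X => |g x|) '' B.carrier) := by
  obtain ⟨c, C, hc, -, h⟩ := B.exists_bounds
  refine ⟨‖g‖ * (1 / c), ?_⟩
  rintro _ ⟨x, hx, rfl⟩
  refine (g.le_opNorm x).trans (mul_le_mul_of_nonneg_left ?_ (_root_.norm_nonneg g))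
  rw [le_div_iff₀ hc, mul_comm]
  exact (h x).1.trans (B.mem_carrier.1 hx)

theorem le_dualNorm (B : EquivBall X) (g : StrongDual ℝ X) {x : X} (hx : B.norm x ≤ 1) :
    |g x| ≤ B.dualNorm g :=
  le_csSup (B.bddAbove_dualNorm g) ⟨x, B.mem_carrier.2 hx, rfl⟩

theorem dualNorm_nonneg (B : EquivBall X) (g : StrongDual ℝ X) : 0 ≤ B.dualNorm g :=
  (abs_nonneg _).trans (B.le_dualNorm g (x := 0) (by rw [norm_zero]; exact zero_le_one))

theorem dualNorm_le (B : EquivBall X) {g : StrongDual ℝ X} {a : ℝ}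
    (h : ∀ x, B.norm x ≤ 1 → |g x| ≤ a) : B.dualNorm g ≤ a := by
  refine csSup_le ⟨_, 0, B.mem_carrier.2 (by rw [norm_zero]; exact zero_le_one), rfl⟩ ?_
  rintro _ ⟨x, hx, rfl⟩
  exact h x (B.mem_carrier.1 hx)

theorem abs_le_of_norm_le (B : EquivBall X) (g : StrongDual ℝ X) {x : X} {a : ℝ} (ha : 0 < a)
    (hx : B.norm x ≤ a) : |g x| ≤ a * B.dualNorm g := by
  have := B.le_dualNorm g (B.norm_inv_smul_le ha hx)
  rwa [map_smul, smul_eq_mul, abs_mul, abs_of_pos (inv_pos.2 ha), inv_mul_le_iff₀ ha] at this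

theorem abs_le_norm_mul (B : EquivBall X) (g : StrongDual ℝ X) (x : X) :
    |g x| ≤ B.norm x * B.dualNorm g := by
  refine ge_of_tendsto (x := 𝓝[>] B.norm x) (f := fun a : ℝ => a * B.dualNorm g) ?_ ?_
  · exact ((continuous_id.mul continuous_const).tendsto _).mono_left nhdsWithin_le_nhds
  · filter_upwards [self_mem_nhdsWithin] with a ha
    exact B.abs_le_of_norm_le g ((B.norm_nonneg x).trans_lt ha) (le_of_lt ha)

theorem exists_lt_apply (B : EquivBall X) (g : StrongDual ℝ X) {a : ℝ} (ha : a < B.dualNorm g) :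
    ∃ x, B.norm x ≤ 1 ∧ a < g x := by
  by_contra! h
  refine ha.not_ge (B.dualNorm_le fun x hx => abs_le.2 ⟨?_, h x hx⟩)
  have := h ((-1 : ℝ) • x) (by rw [norm_smul, abs_neg, abs_one, one_mul]; exact hx)
  rw [map_smul, smul_eq_mul] at this
  linarith

theorem dualNorm_smul (B : EquivBall X) {a : ℝ} (ha : 0 < a) (g : StrongDual ℝ X) :
    B.dualNorm (a • g) = a * B.dualNorm g := by
  have key : ∀ {b : ℝ}, 0 < b → ∀ k : StrongDual ℝ X, B.dualNorm (b • k) ≤ b * B.dualNorm k := by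
    intro b hb k
    refine B.dualNorm_le fun x hx => ?_
    rw [smul_apply, smul_eq_mul, abs_mul, abs_of_pos hb]
    exact mul_le_mul_of_nonneg_left (B.le_dualNorm k hx) hb.le
  refine (key ha g).antisymm ?_
  have := key (inv_pos.2 ha) (a • g)
  rwa [inv_smul_smul₀ ha.ne', le_inv_mul_iff₀ ha] at this

theorem dualNorm_le_mul {B B' : EquivBall X} {k : ℝ} (hk : 0 < k)
    (h : ∀ x, B.norm x ≤ 1 → B'.norm x ≤ k) (g : StrongDual ℝ X) :
    B.dualNorm g ≤ k * B'.dualNorm g :=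
  B.dualNorm_le fun x hx => B'.abs_le_of_norm_le g hk (h x hx)

/-- A half space contains a ball of radius `r` exactly when it contains its centre with
margin `r` times the dual norm. -/
theorem forall_ball_le_iff (B : EquivBall X) (f : StrongDual ℝ X) (z : X) {r γ : ℝ} (hr : 0 < r) :
    (∀ y, B.norm (y - z) ≤ r → γ ≤ f y) ↔ γ + r * B.dualNorm f ≤ f z := by
  constructor
  · intro h
    have : B.dualNorm f ≤ (f z - γ) / r := by
      by_contra! hlt
      obtain ⟨u, hu, hlt⟩ := B.exists_lt_apply f hlt
      have := h (z + (-r) • u) (by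
        rw [add_sub_cancel_left, norm_smul, abs_neg, abs_of_pos hr]
        exact mul_le_of_le_one_right hr.le hu)
      rw [map_add, map_smul, smul_eq_mul] at this
      rw [div_lt_iff₀ hr] at hlt
      linarith
    rw [le_div_iff₀ hr] at this
    linarith
  · intro h y hy
    have := (abs_le.1 (B.abs_le_of_norm_le f hr hy)).1
    rw [map_sub] at this
    linarith

theorem abs_le_normOn_mul (B : EquivBall X) {Z : Submodule ℝ (StrongDual ℝ X)}
    {g : StrongDual ℝ X} (hg : g ∈ Z) (x : X) : |g x| ≤ B.normOn Z x * B.dualNorm g := by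
  rcases (B.dualNorm_nonneg g).eq_or_lt with h0 | hpos
  -- Such a `g` cannot be normalised, but it vanishes everywhere.
  · have := B.abs_le_norm_mul g x
    rwa [← h0, mul_zero] at this ⊢
  · have hbdd : BddAbove ((fun g : StrongDual ℝ X => |g x|) ''
        {g : StrongDual ℝ X | g ∈ Z ∧ B.dualNorm g ≤ 1}) := by
      refine ⟨B.norm x, ?_⟩
      rintro _ ⟨k, ⟨-, hk⟩, rfl⟩
      exact (B.abs_le_norm_mul k x).trans (mul_le_of_le_one_right (B.norm_nonneg x) hk)
    have hmem : (B.dualNorm g)⁻¹ • g ∈ Z ∧ B.dualNorm ((B.dualNorm g)⁻¹ • g) ≤ 1 :=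
      ⟨Z.smul_mem _ hg, by rw [B.dualNorm_smul (inv_pos.2 hpos), inv_mul_cancel₀ hpos.ne']⟩
    have h : |((B.dualNorm g)⁻¹ • g) x| ≤ B.normOn Z x := le_csSup hbdd ⟨_, hmem, rfl⟩
    rwa [smul_apply, smul_eq_mul, abs_mul, abs_of_pos (inv_pos.2 hpos),
      inv_mul_le_iff₀ hpos, mul_comm] at h

theorem normOn_nonneg (B : EquivBall X) (Z : Submodule ℝ (StrongDual ℝ X)) (x : X) :
    0 ≤ B.normOn Z x := by
  refine Real.sSup_nonneg ?_
  rintro _ ⟨g, -, rfl⟩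
  exact abs_nonneg _

theorem normOn_le (B : EquivBall X) {Z : Submodule ℝ (StrongDual ℝ X)} {x : X} {a : ℝ}
    (ha : 0 ≤ a) (h : ∀ g ∈ Z, B.dualNorm g ≤ 1 → |g x| ≤ a) : B.normOn Z x ≤ a := by
  refine Real.sSup_le ?_ ha
  rintro _ ⟨g, ⟨hg, hg1⟩, rfl⟩
  exact h g hg hg1

theorem normOn_le_mul {B B' : EquivBall X} {k : ℝ} (hk : 0 < k)
    (h : ∀ g, B'.dualNorm g ≤ k * B.dualNorm g) (Z : Submodule ℝ (StrongDual ℝ X)) (x : X) :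
    B.normOn Z x ≤ k * B'.normOn Z x := by
  have h0 := B'.normOn_nonneg Z x
  refine B.normOn_le (mul_nonneg hk.le h0) fun g hg hg1 => ?_
  refine (B'.abs_le_normOn_mul hg x).trans ?_
  rw [mul_comm]
  exact mul_le_mul_of_nonneg_right ((h g).trans (mul_le_of_le_one_right hk.le hg1)) h0

end Dual

/-! ### Stability under perturbation and the Gδ property -/

section Separation

variable {X : Type*} [NormedAddCommGroup X] [NormedSpace ℝ X]

/-- The separation condition of `AHUMIP` for given `ε` and `M`. -/
def SeparatesAt (B : EquivBall X) (ε M : ℝ) : Prop :=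
  ∃ γ K : ℝ, 0 < γ ∧ 0 < K ∧
    ∀ f : StrongDual ℝ X, B.dualNorm f = 1 →
      ∃ Z : Submodule ℝ (StrongDual ℝ X), IsWeakStarClosedFiniteCodim Z ∧ f ∈ Z ∧
        ∀ C : Set X, IsClosed C → Convex ℝ C →
          (∀ x ∈ C, B.normOn Z x ≤ M) → (∀ x ∈ C, ε ≤ f x) →
            ∃ (z₀ : X) (r₀ : ℝ), 0 < r₀ ∧ r₀ ≤ K ∧
              (∀ x ∈ C, B.normOn Z (x - z₀) ≤ r₀) ∧
              (∀ y : X, B.norm (y - z₀) ≤ r₀ → γ ≤ f y)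

theorem SeparatesAt.mono {B : EquivBall X} {ε ε' M M' : ℝ} (h : B.SeparatesAt ε M)
    (hε : ε ≤ ε') (hM : M' ≤ M) : B.SeparatesAt ε' M' := by
  obtain ⟨γ, K, hγ, hK, h⟩ := h
  refine ⟨γ, K, hγ, hK, fun f hf => ?_⟩
  obtain ⟨Z, hZ, hfZ, h⟩ := h f hf
  exact ⟨Z, hZ, hfZ, fun C hC hC' hCM hCf =>
    h C hC hC' (fun x hx => (hCM x hx).trans hM) fun x hx => hε.trans (hCf x hx)⟩

/-- The separation condition for functionals that need not have dual norm one. -/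
theorem SeparatesAt.forall_dualNorm_le {B : EquivBall X} {ε M s : ℝ} (hε : 0 < ε)
    (h : B.SeparatesAt (ε / s) M) :
    ∃ γ K : ℝ, 0 < γ ∧ 0 < K ∧
      ∀ f : StrongDual ℝ X, 0 < B.dualNorm f → B.dualNorm f ≤ s →
        ∃ Z : Submodule ℝ (StrongDual ℝ X), IsWeakStarClosedFiniteCodim Z ∧ f ∈ Z ∧
          ∀ C : Set X, IsClosed C → Convex ℝ C →
            (∀ x ∈ C, B.normOn Z x ≤ M) → (∀ x ∈ C, ε ≤ f x) →
              ∃ (z : X) (r : ℝ), 0 < r ∧ r ≤ K ∧ (∀ x ∈ C, B.normOn Z (x - z) ≤ r) ∧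
                B.dualNorm f * (γ + r) ≤ f z := by
  obtain ⟨γ, K, hγ, hK, h⟩ := h
  refine ⟨γ, K, hγ, hK, fun f hf hfs => ?_⟩
  have h1 : B.dualNorm ((B.dualNorm f)⁻¹ • f) = 1 := by
    rw [B.dualNorm_smul (inv_pos.2 hf), inv_mul_cancel₀ hf.ne']
  obtain ⟨Z, hZ, hfZ, h⟩ := h _ h1
  refine ⟨Z, hZ, (Z.smul_mem_iff (inv_pos.2 hf).ne').1 hfZ, fun C hC hC' hCM hCf => ?_⟩
  obtain ⟨z, r, hr, hrK, hz, hy⟩ := h C hC hC' hCM fun x hx => by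
    rw [smul_apply, smul_eq_mul, inv_mul_eq_div]
    exact div_le_div₀ (hε.le.trans (hCf x hx)) (hCf x hx) hf hfs
  refine ⟨z, r, hr, hrK, hz, ?_⟩
  rw [forall_ball_le_iff _ _ _ hr, h1, mul_one, smul_apply, smul_eq_mul,
    le_inv_mul_iff₀ hf] at hy
  exact hy

/-- The separation condition passes to all balls near `B`, for larger `ε` and smaller `M`. -/
theorem SeparatesAt.exists_hausdorff_lt {B : EquivBall X} {ε ε' M M' : ℝ} (h : B.SeparatesAt ε M)
    (hε : 0 < ε) (hεε' : ε < ε') (hM' : 0 < M') (hMM' : M' < M) :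
    ∃ e : ℝ, 0 < e ∧ ∀ B' : EquivBall X, hausdorff B B' < e → B'.SeparatesAt ε' M' := by
  -- The largest distortion that the gaps in `ε` and `M` allow; the cap 2 forces `e ≤ 1`.
  set s := min (min (ε' / ε) (M / M')) 2 with hs
  have hs1 : 1 < s :=
    lt_min (lt_min ((one_lt_div hε).2 hεε') ((one_lt_div hM').2 hMM')) one_lt_two
  have hs0 : 0 < s := one_pos.trans hs1
  have hsε : ε ≤ ε' / s := by
    have : s ≤ ε' / ε := (min_le_left _ _).trans (min_le_left _ _)
    rw [le_div_iff₀ hε] at this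
    rw [le_div_iff₀ hs0]
    linarith
  have hsM : s * M' ≤ M := by
    have : s ≤ M / M' := (min_le_left _ _).trans (min_le_right _ _)
    rwa [le_div_iff₀ hM'] at this
  have hs2 : s ≤ 2 := min_le_right _ _
  obtain ⟨γ, K, hγ, hK, h⟩ := (h.mono hsε le_rfl).forall_dualNorm_le (hε.trans hεε')
  -- Enlarging the radius `r` and rescaling `f` costs `(t ^ 2 - 1) * r ≤ 3 * K * e ≤ γ / 2`; the
  -- other half of `γ` covers `t * (γ / 4)`.
  set e := min (s - 1) (γ / (6 * K)) with he
  have he0 : 0 < e := lt_min (sub_pos.2 hs1) (by positivity)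
  have heK : 6 * K * e ≤ γ := by
    have : e ≤ γ / (6 * K) := min_le_right _ _
    rwa [le_div_iff₀ (by positivity), mul_comm] at this
  set t := 1 + e with ht
  have hts : t ≤ s := by have : e ≤ s - 1 := min_le_left _ _; linarith
  have ht0 : 0 < t := by positivity
  refine ⟨e, he0, fun B' hB' => ⟨γ / 4, t * K, by positivity, by positivity, fun f hf => ?_⟩⟩
  obtain ⟨hBB', hB'B⟩ := norm_le_of_hausdorff_lt hB'
  have hd := dualNorm_le_mul ht0 hBB'
  have hd' := dualNorm_le_mul ht0 hB'B
  have hft : B.dualNorm f ≤ t := by simpa [hf] using hd f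
  have hft' : 1 ≤ t * B.dualNorm f := by simpa [hf] using hd' f
  have hf0 : 0 < B.dualNorm f := by
    by_contra! hle
    have := mul_nonpos_of_nonneg_of_nonpos ht0.le hle
    linarith
  obtain ⟨Z, hZ, hfZ, h⟩ := h f hf0 (hft.trans hts)
  refine ⟨Z, hZ, hfZ, fun C hC hC' hCM hCf => ?_⟩
  obtain ⟨z, r, hr, hrK, hz, hfz⟩ := h C hC hC' (fun x hx =>
    (normOn_le_mul ht0 hd' Z x).trans <|
      (mul_le_mul hts (hCM x hx) (B'.normOn_nonneg Z x) hs0.le).trans hsM) hCf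
  refine ⟨z, t * r, by positivity, mul_le_mul_of_nonneg_left hrK ht0.le, fun x hx =>
    (normOn_le_mul ht0 hd Z _).trans (mul_le_mul_of_nonneg_left (hz x hx) ht0.le), ?_⟩
  rw [forall_ball_le_iff _ _ _ (by positivity), hf, mul_one]
  have h1 : γ + r ≤ t * f z := by
    calc γ + r = 1 * (γ + r) := (one_mul _).symm
      _ ≤ (t * B.dualNorm f) * (γ + r) := mul_le_mul_of_nonneg_right hft' (by positivity)
      _ = t * (B.dualNorm f * (γ + r)) := mul_assoc _ _ _
      _ ≤ t * f z := mul_le_mul_of_nonneg_left hfz ht0.le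
  have he1 : e ≤ 1 := by linarith
  have h2 : t * (γ / 4 + t * r) ≤ γ + r := by
    have hre : r * e ≤ K * e := mul_le_mul_of_nonneg_right hrK he0.le
    have hree : r * e * e ≤ r * e := mul_le_of_le_one_right (by positivity) he1
    have hγe : γ * e ≤ γ := mul_le_of_le_one_right hγ.le he1
    have : t * (γ / 4 + t * r) = γ / 4 + γ * e / 4 + r + 2 * (r * e) + r * e * e := by
      rw [ht]; ring
    linarith
  exact le_of_mul_le_mul_left (h2.trans h1) ht0

theorem isGδ_setOf_AHUMIP : IsGδ {B : EquivBall X | AHUMIP B} := by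
  -- The strict inequalities leave the room in `ε` and `M` that makes `W n` open.
  let W : ℕ → Set (EquivBall X) := fun n =>
    {B | ∃ ε M : ℝ, 0 < ε ∧ ε < 1 / (n + 1) ∧ (n : ℝ) + 1 < M ∧ B.SeparatesAt ε M}
  have hW : {B : EquivBall X | AHUMIP B} = ⋂ n, W n := by
    ext B
    rw [Set.mem_iInter]
    constructor
    · intro h n
      have hn : (0 : ℝ) < 1 / (n + 1) := Nat.one_div_pos_of_nat
      exact ⟨1 / (n + 1) / 2, n + 2, half_pos hn, half_lt_self hn, by linarith,
        h _ _ (half_pos hn) (by have := n.cast_nonneg (α := ℝ); linarith)⟩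
    · intro h ε M hε _
      obtain ⟨m, hm⟩ := exists_nat_one_div_lt hε
      obtain ⟨k, hk⟩ := exists_nat_gt M
      obtain ⟨ε', M', -, hε', hM', hs⟩ := h (max m k)
      have hmk : (m : ℝ) ≤ (max m k : ℕ) := by exact_mod_cast le_max_left m k
      have hkm : (k : ℝ) ≤ (max m k : ℕ) := by exact_mod_cast le_max_right m k
      refine hs.mono (hε'.le.trans (le_trans ?_ hm.le)) (by linarith)
      exact one_div_le_one_div_of_le (by positivity) (by linarith)
  rw [hW]
  refine IsGδ.iInter_of_isOpen fun n B => ?_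
  rintro ⟨ε, M, hε, hεn, hMn, h⟩
  obtain ⟨ε', h1, h2⟩ := exists_between hεn
  obtain ⟨M', h3, h4⟩ := exists_between hMn
  have hM' : 0 < M' := lt_trans (by positivity) h3
  obtain ⟨e, he, h⟩ := h.exists_hausdorff_lt hε h1 hM' h4
  exact ⟨e, he, fun B' hB' => ⟨ε', M', hε.trans h1, h2, h3, h B' hB'⟩⟩

end Separation

/-! ### Minkowski sums and density -/

section Sum

variable {X : Type*} [NormedAddCommGroup X] [NormedSpace ℝ X]

theorem le_of_forall_one_lt_le_mul_real {x y : ℝ} (h : ∀ a : ℝ, 1 < a → x ≤ y * a) : x ≤ y := by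
  refine ge_of_tendsto (x := 𝓝[>] (1 : ℝ)) (f := fun a : ℝ => y * a) ?_ ?_
  · have : Filter.Tendsto (fun a : ℝ => y * a) (𝓝 1) (𝓝 (y * 1)) :=
      (continuous_const.mul continuous_id).tendsto _
    rw [mul_one] at this
    exact this.mono_left nhdsWithin_le_nhds
  · filter_upwards [self_mem_nhdsWithin] with a ha
    exact h a ha

theorem seminorm_le_mul {p q : Seminorm ℝ X} {k : ℝ} (h : ∀ x, p x ≤ 1 → q x ≤ k) (x : X) :
    q x ≤ k * p x := by
  refine ge_of_tendsto (x := 𝓝[>] p x) (f := fun a : ℝ => k * a) ?_ ?_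
  · exact ((continuous_const.mul continuous_id).tendsto _).mono_left nhdsWithin_le_nhds
  · filter_upwards [self_mem_nhdsWithin] with a ha
    have ha0 : 0 < a := (apply_nonneg p x).trans_lt ha
    have := h (a⁻¹ • x) (by
      rw [map_smul_eq_mul, Real.norm_of_nonneg (inv_pos.2 ha0).le, inv_mul_le_iff₀ ha0, mul_one]
      exact le_of_lt ha)
    rwa [map_smul_eq_mul, Real.norm_of_nonneg (inv_pos.2 ha0).le, inv_mul_le_iff₀ ha0,
      mul_comm] at this

/-- Up to closure, the Minkowski sum `B₁ + θ B₂` is the unit ball of an equivalent norm; its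
dual norm is the corresponding combination of the dual norms. -/
theorem exists_dualNorm_eq_add (B₁ B₂ : EquivBall X) {θ : ℝ} (hθ : 0 < θ) :
    ∃ D : EquivBall X, (∀ x, B₁.norm x ≤ 1 → D.norm x ≤ 1) ∧
      (∀ b, 0 < b → (∀ x, B₁.norm x ≤ b * B₂.norm x) →
        ∀ x, D.norm x ≤ 1 → B₁.norm x ≤ 1 + θ * b) ∧
      ∀ g, D.dualNorm g = B₁.dualNorm g + θ * B₂.dualNorm g := by
  obtain ⟨p, ⟨c, C, hc, hC, hp⟩, hpn, -⟩ := B₁.exists_seminorm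
  obtain ⟨q, -, hqn, -⟩ := B₂.exists_seminorm
  obtain ⟨l, hl, hlq⟩ := norm_le_mul_norm B₁ B₂
  simp only [hpn, hqn] at hlq
  set A : Set X := p.closedBall 0 1 + θ • q.closedBall 0 1 with hA
  have hmem : ∀ x y, p x ≤ 1 → q y ≤ 1 → x + θ • y ∈ A := fun x y hx hy =>
    Set.add_mem_add ((p.mem_closedBall_zero).2 hx)
      (Set.smul_mem_smul_set ((q.mem_closedBall_zero).2 hy))
  have hof : ∀ z ∈ A, ∃ x y, p x ≤ 1 ∧ q y ≤ 1 ∧ z = x + θ • y := by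
    rintro _ ⟨x, hx, _, ⟨y, hy, rfl⟩, rfl⟩
    exact ⟨x, y, (p.mem_closedBall_zero).1 hx, (q.mem_closedBall_zero).1 hy, rfl⟩
  have hsub : p.closedBall 0 1 ⊆ A := fun x hx => by
    simpa using hmem x 0 ((p.mem_closedBall_zero).1 hx) (by simp)
  have habs : Absorbent ℝ A :=
    (p.absorbent_closedBall_zero one_pos).mono hsub
  have hconv : Convex ℝ A := (p.convex_closedBall 0 1).add ((q.convex_closedBall 0 1).smul θ)
  have hbal : Balanced ℝ A := (p.balanced_closedBall_zero 1).add
    ((q.balanced_closedBall_zero 1).smul θ)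
  set n : Seminorm ℝ X := gaugeSeminorm hbal hconv habs with hn
  have hn_le : ∀ z ∈ A, n z ≤ 1 := fun z hz => gauge_le_one_of_mem hz
  -- `A` need not be closed, so `n z ≤ 1` only places `z` in `a • A` for every `a > 1`.
  have hn_lt : ∀ z, n z ≤ 1 → ∀ a : ℝ, 1 < a → ∃ x y, p x ≤ 1 ∧ q y ≤ 1 ∧ z = a • (x + θ • y) := by
    intro z hz a ha
    obtain ⟨b, hb, hba, w, hw, rfl⟩ := exists_lt_of_gauge_lt habs (hz.trans_lt ha)
    have ha0 : 0 < a := one_pos.trans ha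
    have hw' : (b / a) • w ∈ A := hbal.smul_mem (by
      rw [Real.norm_of_nonneg (by positivity), div_le_one ha0]; exact hba.le) hw
    obtain ⟨x, y, hx, hy, he⟩ := hof _ hw'
    refine ⟨x, y, hx, hy, ?_⟩
    rw [← he, smul_smul, mul_div_cancel₀ _ ha0.ne']
  have hle : ∀ b, 0 < b → (∀ x, p x ≤ b * q x) → ∀ x, n x ≤ 1 → p x ≤ 1 + θ * b := by
    intro b hb hpq x hx
    refine le_of_forall_one_lt_le_mul_real fun a ha => ?_
    have ha0 : 0 < a := one_pos.trans ha
    obtain ⟨y, z, hy, hz, rfl⟩ := hn_lt x hx a ha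
    have h1 : p z ≤ b := (hpq z).trans (mul_le_of_le_one_right hb.le hz)
    have h2 : p (y + θ • z) ≤ 1 + θ * b := by
      refine (map_add_le_add p _ _).trans (add_le_add hy ?_)
      rw [map_smul_eq_mul, Real.norm_of_nonneg hθ.le]
      exact mul_le_mul_of_nonneg_left h1 hθ.le
    rw [map_smul_eq_mul, Real.norm_of_nonneg ha0.le, mul_comm]
    exact mul_le_mul_of_nonneg_right h2 ha0.le
  have hk : 0 < 1 + θ * l := by positivity
  have hlow : ∀ x, p x ≤ (1 + θ * l) * n x := seminorm_le_mul (hle l hl hlq)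
  have hupp : ∀ x, n x ≤ 1 * p x :=
    seminorm_le_mul fun x hx => hn_le x (hsub ((p.mem_closedBall_zero).2 hx))
  let D : EquivBall X :=
    { carrier := {x | n x ≤ 1}
      isUnitBall := ⟨n, ⟨c / (1 + θ * l), C, div_pos hc hk, hC, fun x =>
        ⟨by
          rw [div_mul_eq_mul_div, div_le_iff₀ hk, mul_comm (n x)]
          exact (hp x).1.trans (hlow x),
        (hupp x).trans (by rw [one_mul]; exact (hp x).2)⟩⟩, rfl⟩ }
  have hDn : ∀ x, D.norm x = n x := D.norm_eq n rfl
  refine ⟨D, ?_, ?_, fun g => le_antisymm ?_ ?_⟩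
  · intro x hx
    rw [hpn] at hx
    rw [hDn]
    exact hn_le x (hsub ((p.mem_closedBall_zero).2 hx))
  · simpa only [hpn, hqn, hDn] using hle
  · refine D.dualNorm_le fun x hx => ?_
    rw [hDn] at hx
    refine le_of_forall_one_lt_le_mul_real fun a ha => ?_
    have ha0 : 0 < a := one_pos.trans ha
    obtain ⟨y, z, hy, hz, rfl⟩ := hn_lt x hx a ha
    have h2 : |g (y + θ • z)| ≤ B₁.dualNorm g + θ * B₂.dualNorm g := by
      rw [map_add, map_smul, smul_eq_mul]
      refine (abs_add_le _ _).trans (add_le_add (B₁.le_dualNorm g (by rwa [hpn])) ?_)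
      rw [abs_mul, abs_of_pos hθ]
      exact mul_le_mul_of_nonneg_left (B₂.le_dualNorm g (by rwa [hqn])) hθ.le
    rw [map_smul, smul_eq_mul, abs_mul, abs_of_pos ha0, mul_comm]
    exact mul_le_mul_of_nonneg_right h2 ha0.le
  · by_contra! hlt
    obtain ⟨x, hx, hgx⟩ := B₁.exists_lt_apply g
      (a := D.dualNorm g - θ * B₂.dualNorm g) (by linarith)
    obtain ⟨y, hy, hgy⟩ := B₂.exists_lt_apply g (a := (D.dualNorm g - g x) / θ) (by
      rw [div_lt_iff₀ hθ]; linarith)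
    rw [div_lt_iff₀ hθ] at hgy
    rw [hpn] at hx
    rw [hqn] at hy
    have := (le_abs_self _).trans
      (D.le_dualNorm g (x := x + θ • y) (by rw [hDn]; exact hn_le _ (hmem x y hx hy)))
    rw [map_add, map_smul, smul_eq_mul] at this
    linarith

/-- Adding a small multiple of a ball with AHUMIP yields AHUMIP. -/
theorem AHUMIP_of_dualNorm_eq_add {B₁ B₂ D : EquivBall X} {θ : ℝ} (hθ : 0 < θ)
    (hD : ∀ g, D.dualNorm g = B₁.dualNorm g + θ * B₂.dualNorm g) (h : AHUMIP B₂) : AHUMIP D := by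
  intro ε M hε hM
  obtain ⟨k, hk, hkn⟩ := norm_le_mul_norm D B₂
  obtain ⟨l, hl, hln⟩ := norm_le_mul_norm B₂ D
  have hB₂D := dualNorm_le_mul hl (B := D) (B' := B₂)
    (fun x hx => (hln x).trans (mul_le_of_le_one_right hl.le hx))
  have hDB₂ := dualNorm_le_mul hk (B := B₂) (B' := D)
    (fun x hx => (hkn x).trans (mul_le_of_le_one_right hk.le hx))
  have hsep : B₂.SeparatesAt (ε / k) (max 1 (l * M)) :=
    h _ _ (div_pos hε hk) (le_max_left _ _)
  obtain ⟨γ, K, hγ, hK, h⟩ := hsep.forall_dualNorm_le hε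
  -- The available margin is `B₂.dualNorm f * γ ≥ γ / l`; half of it is spent on `u`, which only
  -- almost norms `f`.
  refine ⟨γ / (2 * l), K / θ, by positivity, by positivity, fun f hf => ?_⟩
  have hfl : 1 ≤ l * B₂.dualNorm f := by simpa [hf] using hB₂D f
  have hfk : B₂.dualNorm f ≤ k := by simpa [hf] using hDB₂ f
  have hf0 : 0 < B₂.dualNorm f := by
    by_contra! hle
    have := mul_nonpos_of_nonneg_of_nonpos hl.le hle
    linarith
  obtain ⟨Z, hZ, hfZ, h⟩ := h f hf0 hfk
  refine ⟨Z, hZ, hfZ, fun C hC hC' hCM hCf => ?_⟩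
  obtain ⟨z, r, hr, hrK, hz, hfz⟩ := h C hC hC' (fun x hx =>
    ((normOn_le_mul hl hB₂D Z x).trans (mul_le_mul_of_nonneg_left (hCM x hx) hl.le)).trans
      (le_max_right _ _)) hCf
  set ρ := r / θ with hρ
  have hρ0 : 0 < ρ := div_pos hr hθ
  have hρθ : ρ * θ = r := div_mul_cancel₀ r hθ.ne'
  obtain ⟨u, hu, hfu⟩ := B₁.exists_lt_apply f (a := B₁.dualNorm f - γ / (2 * l) / ρ)
    (sub_lt_self _ (by positivity))
  refine ⟨z + ρ • u, ρ, hρ0, div_le_div_of_nonneg_right hrK hθ.le, fun x hx => ?_, ?_⟩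
  · refine D.normOn_le hρ0.le fun g hg hg1 => ?_
    have h1 : |g (x - z)| ≤ r * B₂.dualNorm g := (B₂.abs_le_normOn_mul hg _).trans
      (mul_le_mul_of_nonneg_right (hz x hx) (B₂.dualNorm_nonneg g))
    have h2 : |ρ * g u| ≤ ρ * B₁.dualNorm g := by
      rw [abs_mul, abs_of_pos hρ0]
      exact mul_le_mul_of_nonneg_left (B₁.le_dualNorm g hu) hρ0.le
    have h3 : g (x - (z + ρ • u)) = g (x - z) - ρ * g u := by
      simp only [map_sub, map_add, map_smul, smul_eq_mul]; ring
    rw [h3]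
    calc |g (x - z) - ρ * g u| ≤ |g (x - z)| + |ρ * g u| := abs_sub _ _
      _ ≤ r * B₂.dualNorm g + ρ * B₁.dualNorm g := add_le_add h1 h2
      _ = ρ * D.dualNorm g := by rw [hD, ← hρθ]; ring
      _ ≤ ρ := mul_le_of_le_one_right hρ0.le hg1
  · rw [forall_ball_le_iff _ _ _ hρ0, hf, mul_one, map_add, map_smul, smul_eq_mul]
    have h1 : ρ * B₁.dualNorm f - γ / (2 * l) ≤ ρ * f u := by
      have := mul_le_mul_of_nonneg_left hfu.le hρ0.le
      rwa [mul_sub, mul_div_cancel₀ _ hρ0.ne'] at this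
    have h2 : γ / l ≤ B₂.dualNorm f * γ := by
      rw [div_le_iff₀ hl]
      calc γ = 1 * γ := (one_mul γ).symm
        _ ≤ (l * B₂.dualNorm f) * γ := mul_le_mul_of_nonneg_right hfl hγ.le
        _ = B₂.dualNorm f * γ * l := by ring
    have h3 : ρ * B₁.dualNorm f + B₂.dualNorm f * r = ρ := by
      calc _ = ρ * (B₁.dualNorm f + θ * B₂.dualNorm f) := by rw [← hρθ]; ring
        _ = ρ := by rw [← hD, hf, mul_one]
    have h4 : γ / l = γ / (2 * l) + γ / (2 * l) := by field_simp; norm_num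
    linarith

theorem dense_setOf_AHUMIP {B₀ : EquivBall X} (h : AHUMIP B₀) :
    Dense {B : EquivBall X | AHUMIP B} := by
  refine dense_iff_inter_open.2 ?_
  rintro U hU ⟨B, hB⟩
  obtain ⟨e, he, hUe⟩ := hU B hB
  obtain ⟨b, hb, hb'⟩ := norm_le_mul_norm B B₀
  -- With this `θ` the ball of `D` lies in `(1 + θ * b) B = (1 + e / 2) B`.
  have hθ : 0 < e / (2 * b) := by positivity
  obtain ⟨D, h1, h2, h3⟩ := exists_dualNorm_eq_add B B₀ hθ
  refine ⟨D, hUe D (lt_of_le_of_lt ?_ (half_lt_self he)), AHUMIP_of_dualNorm_eq_add hθ h3 h⟩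
  refine hausdorff_le (half_pos he) (fun x hx => (h1 x hx).trans (by linarith)) fun x hx => ?_
  have := h2 b hb hb' x hx
  rwa [show e / (2 * b) * b = e / 2 by field_simp] at this

end Sum

end EquivBall

theorem mainTheorem2 {X : Type*} [NormedAddCommGroup X] [NormedSpace ℝ X] [CompleteSpace X]
    (hX : AHUMIP (EquivBall.original X)) :
    ∃ S : Set (EquivBall X), Dense S ∧ IsGδ S ∧ ∀ B ∈ S, AHUMIP B :=
  ⟨{B | AHUMIP B}, EquivBall.dense_setOf_AHUMIP hX, EquivBall.isGδ_setOf_AHUMIP, fun _ h => h⟩
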